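/- Let $x>0$ and $0\le b<1$ be real, and put $\alpha=1-b-x$. Define $g_n=g_n(x,b)$, $n\ge 1$, by $g_1=\alpha b$ and, for $n\ge1$, $$(n+1)^2g_{n+1}=n(n+\alpha+b-g_1)g_n+\sum_{k=0}^{n-2}(k+1)g_{k+1}\bigl[(n-k-1)g_{n-k-1}-(n-k)g_{n-k}\bigr].$$ The joint factor is $f(x,b)=\exp\bigl[-\sum_{n\ge1}g_n(x,b)\bigr]$, where $\sum_{n\ge 1}g_n(x,b)$ denotes $\lim_{t\to1^-}G(t)$ for the real-analytic continuation $G$ to $[0,1)$ of the power series $\sum_{n\ge1}g_n(x,b)t^n$ (near $t=0$). Then: 1. this continuation and limit exist, so that $f(x,b)$ is well defined (and unique); 2. whenever the series $\sum_{n\ge1}g_n(x,b)$ converges, $f(x,b)=\exp\bigl[-\sum_{n\ge1}g_n(x,b)\bigr]$ with the ordinary sum, and the series converges absolutely at least when $x+b\le2$; 3. the joint factor has the (unconditionally convergent) infinite-product representation $$f(x,b)=\prod_{k=1}^{\infty}\frac{k(x+k-1)}{(k-b)(x+k+b-1)};$$ 4. equivalently, $\Gamma(x+b)\Gamma(1-b)/\Gamma(x)=f(x,b)$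 equals this product. -/

import Mathlib

/-- The coefficients `g_n(α, b)` given by `g_1 = α b` and, for `n ≥ 1`, by the recursive algorithm
`(n+1)² g_{n+1} = n (n + α + b - g_1) g_n
  + ∑_{k=0}^{n-2} (k+1) g_{k+1} [(n-k-1) g_{n-k-1} - (n-k) g_{n-k}]`
(see `hyperLogCoeff_rec`). The value at index `0`, the constant term, is `0`. -/
noncomputable def hyperLogCoeff (α b : ℝ) : ℕ → ℝ
  | 0 => 0
  | 1 => α * b
  | n + 2 =>
      (((n : ℝ) + 1) * ((n : ℝ) + 1 + α + b - α * b) * hyperLogCoeff α b (n + 1)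
        + ∑ k : Fin n, (((k : ℕ) : ℝ) + 1) * hyperLogCoeff α b ((k : ℕ) + 1)
            * (((n : ℝ) - ((k : ℕ) : ℝ)) * hyperLogCoeff α b (n - (k : ℕ))
              - ((n : ℝ) + 1 - ((k : ℕ) : ℝ)) * hyperLogCoeff α b (n + 1 - (k : ℕ))))
        / ((n : ℝ) + 2) ^ 2

/-- The defining recursion, in its usual form. -/
theorem hyperLogCoeff_rec (α b : ℝ) (n : ℕ) (hn : 1 ≤ n) :
    ((n : ℝ) + 1) ^ 2 * hyperLogCoeff α b (n + 1) =
      (n : ℝ) * ((n : ℝ) + α + b - hyperLogCoeff α b 1) * hyperLogCoeff α b n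
        + ∑ k ∈ Finset.range (n - 1), ((k : ℝ) + 1) * hyperLogCoeff α b (k + 1)
            * (((n : ℝ) - (k : ℝ) - 1) * hyperLogCoeff α b (n - k - 1)
              - ((n : ℝ) - (k : ℝ)) * hyperLogCoeff α b (n - k)) := by
  obtain ⟨m, rfl⟩ : ∃ m, n = m + 1 := ⟨n - 1, by omega⟩
  have h : ((m : ℝ) + 2) ^ 2 ≠ 0 := by positivity
  rw [Finset.sum_range, hyperLogCoeff.eq_3, hyperLogCoeff.eq_2]
  push_cast
  rw [show (m : ℝ) + 1 + 1 = m + 2 by ring, mul_div_cancel₀ _ h]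
  congr 1
  refine Finset.sum_congr rfl fun k _ => ?_
  rw [show m + 1 - (k : ℕ) - 1 = m - (k : ℕ) by omega]
  ring

/-- `g_n(x, b)`: the coefficients above with `α = 1 - b - x`. -/
noncomputable def jointCoeff (x b : ℝ) (n : ℕ) : ℝ := hyperLogCoeff (1 - b - x) b n

/-- `f` is the joint factor at `(x, b)`: `f = exp (-s)`, where `s = ∑_{n ≥ 1} g_n(x, b)`.
The sum `s` is the value at `t = 1` of the function `G(t) = ∑_{n ≥ 1} g_n(x, b) t ^ n`. As the
radius of convergence of this series can be less than `1`, `G` is continued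
analytically along `[0, 1)` and `s` is its limit at `1` from the left; by Abel's
theorem `s` is the ordinary sum whenever the series `∑ g_n(x, b)` converges. -/
def IsJointFactor (x b f : ℝ) : Prop :=
  ∃ (G : ℝ → ℝ) (s : ℝ),
    HasFPowerSeriesAt G (FormalMultilinearSeries.ofScalars ℝ (jointCoeff x b)) 0 ∧
    AnalyticOnNhd ℝ G (Set.Ico 0 1) ∧
    Filter.Tendsto G (nhdsWithin 1 (Set.Iio 1)) (nhds s) ∧
    f = Real.exp (-s)

/-! The numbers g_n are the Taylor coefficients of log F, where F(t) = ₂F₁(α, b; 1; t). The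
hypergeometric equation for F turns into a Riccati equation for F'/F, and its coefficients satisfy
the given recursion (`mk_hyperLogCoeff_mul_hgSeries`, `hasFPowerSeriesAt_log_seriesSum`). Euler's
transformation F(t) = (1 - t)^x ₂F₁(x + b, 1 - b; 1; t) shows F > 0 on [0, 1), so log F is the
required continuation. Since α + b = 1 - x < 1, the series of F converges at 1, to L say; by Abel's
theorem F(t) → L, and the joint factor is 1/L.

The value of L is Gauss's sum. Raising the third parameter from N + 1 to N + 2 multiplies the sum at
1 by one factor of the product (`tsum_shiftedCoeff_succ`), and the sum tends to 1 as N → ∞, so the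
product is 1/L (`gamma_mul_tsum_hgCoeff`). Euler's limit formula evaluates the same product by Gamma
functions.

For absolute convergence, x + b ≤ 2 means α ≥ -1. The g_n then all have one sign, and comparing
truncations of F'/F with F'/F itself bounds the partial sums by the value ± log L
(`summable_hyperLogCoeff_of_sign`). -/

open PowerSeries Filter Topology

/-! ### Formal hypergeometric series: differential equation, Euler's transformation, Riccati
equation -/

/-- The coefficients `(a)_n (b)_n / (n!)²` of the hypergeometric series `₂F₁(a, b; 1; t)`. -/
noncomputable def hgCoeff (a b : ℝ) : ℕ → ℝ
  | 0 => 1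
  | n + 1 => (a + n) * (b + n) / ((n : ℝ) + 1) ^ 2 * hgCoeff a b n

/-- The formal hypergeometric series `₂F₁(a, b; 1; X)`. -/
noncomputable def hgSeries (a b : ℝ) : ℝ⟦X⟧ := PowerSeries.mk (hgCoeff a b)

theorem hgCoeff_succ (a b : ℝ) (n : ℕ) :
    ((n : ℝ) + 1) ^ 2 * hgCoeff a b (n + 1) = (a + n) * (b + n) * hgCoeff a b n := by
  rw [hgCoeff]
  field_simp

theorem coeff_X_mul_derivative (f : ℝ⟦X⟧) (n : ℕ) :
    coeff n (X * derivative ℝ f) = n * coeff n f := by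
  cases n with
  | zero => simp
  | succ n => rw [coeff_succ_X_mul, coeff_derivative]; push_cast; ring

/-- The hypergeometric differential equation, with `θ = X d/dX`, for formal power series. -/
def IsHgSolution (a b : ℝ) (Z : ℝ⟦X⟧) : Prop :=
  derivative ℝ (X * derivative ℝ Z) =
    X * derivative ℝ (X * derivative ℝ Z) + C (a + b) * (X * derivative ℝ Z) + C (a * b) * Z

theorem isHgSolution_iff (a b : ℝ) (Z : ℝ⟦X⟧) :
    IsHgSolution a b Z ↔
      ∀ n : ℕ, ((n : ℝ) + 1) ^ 2 * coeff (n + 1) Z = (a + n) * (b + n) * coeff n Z := by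
  rw [IsHgSolution, PowerSeries.ext_iff]
  refine forall_congr' fun n => ?_
  obtain ⟨s, hs⟩ : ∃ s, s = a + b := ⟨_, rfl⟩
  rw [← hs]
  simp only [map_add, coeff_C_mul, coeff_X_mul_derivative, coeff_derivative (X * _)]
  push_cast
  constructor <;> intro h
  · linear_combination h + n * coeff n Z * hs
  · linear_combination h - n * coeff n Z * hs

theorem isHgSolution_hgSeries (a b : ℝ) : IsHgSolution a b (hgSeries a b) := by
  rw [isHgSolution_iff]
  intro n
  simpa [hgSeries] using hgCoeff_succ a b n

theorem IsHgSolution.eq_hgSeries {a b : ℝ} {Z : ℝ⟦X⟧} (hZ : IsHgSolution a b Z)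
    (h0 : coeff 0 Z = 1) : Z = hgSeries a b := by
  rw [isHgSolution_iff] at hZ
  ext n
  rw [hgSeries, coeff_mk]
  induction n with
  | zero => simpa [hgCoeff] using h0
  | succ n ih =>
    have h := hZ n
    rw [ih, ← hgCoeff_succ] at h
    exact mul_left_cancel₀ (by positivity) h

theorem hgSeries_ne_zero (a b : ℝ) : hgSeries a b ≠ 0 := by
  intro h
  have := congrArg (coeff 0) h
  simp [hgSeries, hgCoeff] at this

theorem one_sub_X_ne_zero : (1 - X : ℝ⟦X⟧) ≠ 0 := by
  intro h
  have := congrArg (coeff 0) h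
  simp at this

/-- Euler's transformation for formal power series; `P` stands for `(1 - X) ^ x`. -/
theorem euler_transformation (x b : ℝ) {P : ℝ⟦X⟧} (h0 : coeff 0 P = 1)
    (hP : (1 - X) * derivative ℝ P = -(C x * P)) :
    P * hgSeries (x + b) (1 - b) = hgSeries (1 - b - x) b := by
  apply IsHgSolution.eq_hgSeries
  · have hY := isHgSolution_hgSeries (x + b) (1 - b)
    set Y := hgSeries (x + b) (1 - b)
    have hP' := congrArg (derivative ℝ) hP
    unfold IsHgSolution at hY ⊢
    simp only [Derivation.leibniz, smul_eq_mul, map_add, map_sub, map_neg, derivative_X,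
      derivative_C, map_one, map_mul, derivative_one] at hY hP' ⊢
    set P1 := derivative ℝ P
    set P2 := derivative ℝ P1
    set Y1 := derivative ℝ Y
    set Y2 := derivative ℝ Y1
    -- The equation for `P` controls only (1 - X) P', so the factor 1 - X is what allows P' and P''
    -- to be eliminated.
    apply mul_left_cancel₀ one_sub_X_ne_zero
    linear_combination ((1 - X) * P) * hY + (X * (1 - X) * Y) * hP' +
      ((1 - X) * Y + 2 * X * (1 - X) * Y1) * hP
  · simp [coeff_mul, h0, hgSeries, hgCoeff]

/-- The logarithmic derivative of the hypergeometric series, by its Riccati equation. -/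
theorem mk_hyperLogCoeff_mul_hgSeries (α b : ℝ) :
    PowerSeries.mk (fun n : ℕ => ((n : ℝ) + 1) * hyperLogCoeff α b (n + 1)) * hgSeries α b =
      derivative ℝ (hgSeries α b) := by
  have hA := isHgSolution_hgSeries α b
  have hne := hgSeries_ne_zero α b
  have h0 : constantCoeff (hgSeries α b) ≠ 0 := by
    rw [← coeff_zero_eq_constantCoeff_apply]
    simp [hgSeries, hgCoeff]
  set A := hgSeries α b
  obtain ⟨U, hU⟩ : ∃ U : ℝ⟦X⟧, U * A = derivative ℝ A :=
    ⟨derivative ℝ A * A⁻¹, by rw [mul_assoc, PowerSeries.inv_mul_cancel _ h0, mul_one]⟩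
  -- The Riccati equation: substitute A' = U A into the hypergeometric equation and cancel A.
  have hR : derivative ℝ (X * U) + X * (U * U) =
      X * (derivative ℝ (X * U) + X * (U * U)) + C (α + b) * (X * U) + C (α * b) := by
    apply mul_right_cancel₀ hne
    unfold IsHgSolution at hA
    rw [← hU, ← mul_assoc, Derivation.leibniz, ← hU, smul_eq_mul, smul_eq_mul] at hA
    linear_combination hA
  rw [← hU]
  congr 1
  have hrec : ∀ m : ℕ, ((m : ℝ) + 2) * coeff (m + 1) U + coeff m (U * U) =
      (m + 1 + α + b) * coeff m U + coeff m (X * (U * U)) := by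
    intro m
    have h := congrArg (coeff (m + 1)) hR
    obtain ⟨s, hs⟩ : ∃ s, s = α + b := ⟨_, rfl⟩
    rw [← hs] at h
    simp only [map_add, coeff_C_mul, coeff_succ_X_mul, coeff_derivative, coeff_C] at h
    push_cast at h
    linear_combination h + coeff m U * hs
  have hU0 : coeff 0 U = α * b := by
    have h := congrArg (coeff 0) hR
    simpa [coeff_derivative, coeff_succ_X_mul] using h
  symm
  ext n
  induction n using Nat.strong_induction_on with
  | _ n ih =>
    rw [coeff_mk]
    rcases n with _ | m
    · simp [hU0, hyperLogCoeff]
    have hg : ∀ k ≤ m, coeff k U = ((k : ℝ) + 1) * hyperLogCoeff α b (k + 1) := by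
      intro k hk
      rw [ih k (by omega), coeff_mk]
    have h1 := hrec m
    have h2 := hyperLogCoeff_rec α b (m + 1) (by omega)
    -- The split-off term k = m of U² contains U_0 = α b; it produces the `- g_1` of the recursion.
    rw [coeff_mul, Finset.Nat.sum_antidiagonal_eq_sum_range_succ_mk, Finset.sum_range_succ] at h1
    have h3 : coeff m (X * (U * U)) = ∑ k ∈ Finset.range m, coeff k U * coeff (m - 1 - k) U := by
      rcases m with _ | m
      · simp
      · rw [coeff_succ_X_mul, coeff_mul, Finset.Nat.sum_antidiagonal_eq_sum_range_succ_mk]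
        rfl
    have h4 : ∑ k ∈ Finset.range m, ((k : ℝ) + 1) * hyperLogCoeff α b (k + 1)
            * ((((m + 1 : ℕ) : ℝ) - (k : ℝ) - 1) * hyperLogCoeff α b (m + 1 - k - 1)
              - (((m + 1 : ℕ) : ℝ) - (k : ℝ)) * hyperLogCoeff α b (m + 1 - k)) =
        ∑ k ∈ Finset.range m, coeff k U * coeff (m - 1 - k) U -
          ∑ k ∈ Finset.range m, coeff k U * coeff (m - k) U := by
      rw [← Finset.sum_sub_distrib]
      refine Finset.sum_congr rfl fun k hk => ?_
      have hk' := Finset.mem_range.1 hk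
      obtain ⟨j, rfl⟩ : ∃ j, m = k + 1 + j := ⟨m - k - 1, by omega⟩
      rw [show k + 1 + j - 1 - k = j by omega, show k + 1 + j - k = j + 1 by omega,
        show k + 1 + j + 1 - k - 1 = j + 1 by omega, show k + 1 + j + 1 - k = j + 2 by omega,
        hg k (by omega), hg j (by omega), hg (j + 1) (by omega)]
      push_cast
      ring
    rw [h3] at h1
    simp only [Nat.add_sub_cancel] at h2
    rw [h4] at h2
    simp only [Nat.sub_self, hU0] at h1
    rw [show hyperLogCoeff α b 1 = α * b from by rw [hyperLogCoeff]] at h2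
    have hm := hg m le_rfl
    have hne2 : (m : ℝ) + 2 ≠ 0 := by positivity
    apply mul_left_cancel₀ hne2
    push_cast at h2 ⊢
    linear_combination h1 - h2 + (m + 1 + α + b - α * b) * hm

/-! ### Passage from analytic functions to formal power series -/

/-- The Taylor series at `0`. -/
noncomputable def taylorSeries (f : ℝ → ℝ) : ℝ⟦X⟧ :=
  PowerSeries.mk fun n => iteratedDeriv n f 0 / n.factorial

theorem taylorSeries_mul {f g : ℝ → ℝ} (hf : AnalyticAt ℝ f 0) (hg : AnalyticAt ℝ g 0) :
    taylorSeries (f * g) = taylorSeries f * taylorSeries g := by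
  ext
  simp only [taylorSeries, coeff_mk, iteratedDeriv_mul hf.contDiffAt hg.contDiffAt,
    Finset.sum_div, PowerSeries.coeff_mul,
    Finset.Nat.sum_antidiagonal_eq_sum_range_succ_mk, Nat.succ_eq_add_one]
  refine Finset.sum_congr rfl fun i hi ↦ ?_
  rw [Nat.cast_choose _ (by grind)]
  field_simp [Nat.factorial_ne_zero]

theorem taylorSeries_deriv (f : ℝ → ℝ) :
    taylorSeries (deriv f) = derivative ℝ (taylorSeries f) := by
  ext n
  rw [coeff_derivative, taylorSeries, taylorSeries, coeff_mk, coeff_mk, ← iteratedDeriv_succ',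
    Nat.factorial_succ]
  push_cast
  field_simp

theorem taylorSeries_congr {f g : ℝ → ℝ} (h : f =ᶠ[𝓝 0] g) : taylorSeries f = taylorSeries g := by
  ext n
  rw [taylorSeries, taylorSeries, coeff_mk, coeff_mk, h.iteratedDeriv_eq]

theorem coeff_zero_taylorSeries (f : ℝ → ℝ) : coeff 0 (taylorSeries f) = f 0 := by
  simp [taylorSeries]

theorem taylorSeries_neg_const_mul (x : ℝ) (f : ℝ → ℝ) :
    taylorSeries (fun u => -(x * f u)) = -(C x * taylorSeries f) := by
  ext n
  have h : (fun u => -(x * f u)) = fun u => (-x) * f u := by funext u; ring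
  rw [taylorSeries, coeff_mk, map_neg, coeff_C_mul, taylorSeries, coeff_mk, h,
    iteratedDeriv_const_mul_field]
  ring

theorem taylorSeries_one_sub : taylorSeries (fun u => 1 - u) = 1 - X := by
  ext n
  rw [taylorSeries, coeff_mk]
  rcases n with _ | n
  · simp
  · rw [iteratedDeriv_succ', map_sub, coeff_X, coeff_one]
    have : deriv (fun u : ℝ => 1 - u) = fun _ => -1 := by
      funext u
      simp
    rw [this, iteratedDeriv_const]
    rcases n with _ | n <;> simp

theorem taylorSeries_eq_mk {f : ℝ → ℝ} {c : ℕ → ℝ}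
    (h : HasFPowerSeriesAt f (FormalMultilinearSeries.ofScalars ℝ c) 0) :
    taylorSeries f = PowerSeries.mk c := by
  have h1 := h.eq_formalMultilinearSeries h.analyticAt.hasFPowerSeriesAt
  rw [taylorSeries, ← FormalMultilinearSeries.ofScalars_series_injective ℝ ℝ h1]

theorem AnalyticAt.hasFPowerSeriesAt_of_taylorSeries_eq {f : ℝ → ℝ} {c : ℕ → ℝ}
    (hf : AnalyticAt ℝ f 0) (h : taylorSeries f = PowerSeries.mk c) :
    HasFPowerSeriesAt f (FormalMultilinearSeries.ofScalars ℝ c) 0 := by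
  have h1 : (fun n : ℕ => iteratedDeriv n f 0 / n.factorial) = c := by
    funext n
    simpa [taylorSeries] using congrArg (coeff n) h
  rw [← h1]
  exact hf.hasFPowerSeriesAt

/-! ### Power series on the open unit disc -/

/-- The formal power series `Z` converges on the open unit disc. -/
def ConvergesOnUnitDisc (Z : ℝ⟦X⟧) : Prop :=
  ∀ t : ℝ, |t| < 1 → Summable fun n => ‖coeff n Z * t ^ n‖

/-- The sum of a formal power series. -/
noncomputable def seriesSum (Z : ℝ⟦X⟧) (t : ℝ) : ℝ := ∑' n, coeff n Z * t ^ n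

theorem seriesSum_zero (Z : ℝ⟦X⟧) : seriesSum Z 0 = coeff 0 Z := by
  rw [seriesSum, tsum_eq_single 0]
  · simp
  · intro n hn
    simp [hn]

namespace ConvergesOnUnitDisc

variable {Z W : ℝ⟦X⟧}

theorem of_bounded {K : ℝ} (h : ∀ n, |coeff n Z| ≤ K) : ConvergesOnUnitDisc Z := by
  intro t ht
  refine Summable.of_nonneg_of_le (fun _ => norm_nonneg _) (fun n => ?_)
    ((summable_geometric_of_lt_one (abs_nonneg t) ht).mul_left K)
  rw [norm_mul, norm_pow, Real.norm_eq_abs, Real.norm_eq_abs]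
  exact mul_le_mul_of_nonneg_right (h n) (by positivity)

theorem mul (hZ : ConvergesOnUnitDisc Z) (hW : ConvergesOnUnitDisc W) :
    ConvergesOnUnitDisc (Z * W) := by
  intro t ht
  refine (summable_norm_sum_mul_antidiagonal_of_summable_norm (hZ t ht) (hW t ht)).congr fun n => ?_
  rw [coeff_mul, Finset.sum_mul]
  congr 1
  refine Finset.sum_congr rfl fun p hp => ?_
  rw [← Finset.HasAntidiagonal.mem_antidiagonal.1 hp, pow_add]
  ring

theorem seriesSum_mul (hZ : ConvergesOnUnitDisc Z) (hW : ConvergesOnUnitDisc W) {t : ℝ}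
    (ht : |t| < 1) : seriesSum (Z * W) t = seriesSum Z t * seriesSum W t := by
  rw [seriesSum, seriesSum, seriesSum,
    tsum_mul_tsum_eq_tsum_sum_antidiagonal_of_summable_norm (hZ t ht) (hW t ht)]
  refine tsum_congr fun n => ?_
  rw [coeff_mul, Finset.sum_mul]
  refine Finset.sum_congr rfl fun p hp => ?_
  rw [← Finset.HasAntidiagonal.mem_antidiagonal.1 hp, pow_add]
  ring

theorem one_le_radius (hZ : ConvergesOnUnitDisc Z) :
    1 ≤ (FormalMultilinearSeries.ofScalars ℝ fun n => coeff n Z).radius := by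
  refine ENNReal.le_of_forall_nnreal_lt fun r hr => ?_
  refine FormalMultilinearSeries.le_radius_of_summable_norm _ ?_
  have hr' : (r : ℝ) < 1 := by exact_mod_cast hr
  refine (hZ r (by rwa [abs_of_nonneg r.coe_nonneg])).congr fun n => ?_
  rw [FormalMultilinearSeries.ofScalars_norm, norm_mul, norm_pow, Real.norm_eq_abs (r : ℝ),
    abs_of_nonneg r.coe_nonneg]

theorem hasFPowerSeriesOnBall (hZ : ConvergesOnUnitDisc Z) :
    HasFPowerSeriesOnBall (seriesSum Z)
      (FormalMultilinearSeries.ofScalars ℝ fun n => coeff n Z) 0 1 := by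
  have h := (FormalMultilinearSeries.ofScalars ℝ fun n => coeff n Z).hasFPowerSeriesOnBall
    (lt_of_lt_of_le one_pos hZ.one_le_radius)
  have h2 := h.mono one_pos hZ.one_le_radius
  convert h2 using 1
  funext t
  exact (FormalMultilinearSeries.ofScalars_sum_eq (fun n => coeff n Z) t).symm

theorem analyticOnNhd (hZ : ConvergesOnUnitDisc Z) :
    AnalyticOnNhd ℝ (seriesSum Z) (Metric.eball 0 1) :=
  hZ.hasFPowerSeriesOnBall.analyticOnNhd

theorem taylorSeries_seriesSum (hZ : ConvergesOnUnitDisc Z) : taylorSeries (seriesSum Z) = Z := by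
  rw [taylorSeries_eq_mk hZ.hasFPowerSeriesOnBall.hasFPowerSeriesAt]
  ext n
  simp

end ConvergesOnUnitDisc

theorem mem_eball_zero_one {t : ℝ} : t ∈ Metric.eball (0 : ℝ) 1 ↔ |t| < 1 := by
  rw [show (1 : ENNReal) = ENNReal.ofReal 1 by simp, Metric.eball_ofReal]
  simp

/-- Analytic functions are determined by their Taylor series at `0`. -/
theorem eqOn_of_taylorSeries_eq {f g : ℝ → ℝ} {s : Set ℝ} (hf : AnalyticOnNhd ℝ f s)
    (hg : AnalyticOnNhd ℝ g s) (hs : IsPreconnected s) (h0 : (0 : ℝ) ∈ s)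
    (h : taylorSeries f = taylorSeries g) : Set.EqOn f g s := by
  refine hf.eqOn_of_preconnected_of_eventuallyEq hg hs h0 ?_
  have h1 := (hf 0 h0).hasFPowerSeriesAt_of_taylorSeries_eq (c := fun n => coeff n (taylorSeries g))
    (by rw [h]; ext n; simp)
  have h2 := (hg 0 h0).hasFPowerSeriesAt_of_taylorSeries_eq (c := fun n => coeff n (taylorSeries g))
    (by ext n; simp)
  have h3 := h1.eventually_hasSum_sub
  have h4 := h2.eventually_hasSum_sub
  filter_upwards [h3, h4] with y h5 h6 using h5.unique h6

theorem ConvergesOnUnitDisc.derivative {Z : ℝ⟦X⟧} (hZ : ConvergesOnUnitDisc Z) :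
    ConvergesOnUnitDisc (derivative ℝ Z) := by
  intro t ht
  obtain ⟨r, hr1, hr2⟩ := exists_between ht
  have hr0 : 0 < r := (abs_nonneg t).trans_lt hr1
  have h1 := hZ r (by rwa [abs_of_pos hr0])
  have h2 : Tendsto (fun n : ℕ => ((n : ℝ) + 1) * (|t| / r) ^ n) atTop (𝓝 0) := by
    have hq : |t| / r < 1 := (div_lt_one hr0).2 hr1
    have hq0 : 0 ≤ |t| / r := by positivity
    have := (tendsto_self_mul_const_pow_of_lt_one hq0 hq).add
      (tendsto_pow_atTop_nhds_zero_of_lt_one hq0 hq)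
    simpa [add_mul] using this
  -- The threshold is r because the comparison series is shifted: its n-th term carries r ^ (n + 1).
  have h3 : ∀ᶠ n : ℕ in atTop, ((n : ℝ) + 1) * (|t| / r) ^ n ≤ r :=
    (h2.eventually_lt_const hr0).mono fun _ h => h.le
  refine Summable.of_norm_bounded_eventually_nat ((summable_nat_add_iff 1).2 h1) ?_
  filter_upwards [h3] with n hn
  rw [norm_norm, coeff_derivative, norm_mul, norm_mul, norm_mul, norm_pow, norm_pow,
    Real.norm_eq_abs t, Real.norm_eq_abs r, abs_of_pos hr0, Real.norm_eq_abs ((n : ℝ) + 1),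
    abs_of_pos (by positivity : (0 : ℝ) < n + 1), mul_assoc, pow_succ]
  refine mul_le_mul_of_nonneg_left ?_ (norm_nonneg _)
  rw [div_pow, mul_div_assoc', div_le_iff₀ (by positivity)] at hn
  linarith

/-- Both sides are analytic on the disc with the same Taylor series at 0, so no termwise
differentiation is needed. -/
theorem ConvergesOnUnitDisc.hasDerivAt_seriesSum {Z : ℝ⟦X⟧} (hZ : ConvergesOnUnitDisc Z) {t : ℝ}
    (ht : |t| < 1) : HasDerivAt (seriesSum Z) (seriesSum (PowerSeries.derivative ℝ Z) t) t := by
  have h := eqOn_of_taylorSeries_eq hZ.analyticOnNhd.deriv hZ.derivative.analyticOnNhd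
    (Metric.isConnected_eball one_pos).isPreconnected (by simp)
    (by rw [taylorSeries_deriv, hZ.taylorSeries_seriesSum, hZ.derivative.taylorSeries_seriesSum])
  have ht' := mem_eball_zero_one.2 ht
  rw [← h ht']
  exact (hZ.analyticOnNhd t ht').differentiableAt.hasDerivAt

/-! ### The hypergeometric function and its logarithm on [0, 1) -/

theorem tendsto_hgCoeff_ratio (a b : ℝ) :
    Tendsto (fun n : ℕ => (a + n) * (b + n) / ((n : ℝ) + 1) ^ 2) atTop (𝓝 1) := by
  have h : ∀ a : ℝ, Tendsto (fun n : ℕ => (a + n) / ((n : ℝ) + 1)) atTop (𝓝 1) := by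
    intro a
    have h1 := (tendsto_one_div_add_atTop_nhds_zero_nat (𝕜 := ℝ)).const_mul (a - 1)
    have h2 := h1.const_add 1
    rw [mul_zero, add_zero] at h2
    refine h2.congr fun n => ?_
    have : (n : ℝ) + 1 ≠ 0 := by positivity
    field_simp
    ring
  have := (h a).mul (h b)
  rw [one_mul] at this
  refine this.congr fun n => ?_
  rw [div_mul_div_comm, sq]

theorem convergesOnUnitDisc_hgSeries (a b : ℝ) : ConvergesOnUnitDisc (hgSeries a b) := by
  intro t ht
  have h1 : Tendsto (fun n : ℕ => |(a + n) * (b + n) / ((n : ℝ) + 1) ^ 2| * |t|) atTop (𝓝 |t|) := by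
    simpa using (tendsto_hgCoeff_ratio a b).abs.mul_const |t|
  obtain ⟨r, hr1, hr2⟩ := exists_between ht
  refine summable_of_ratio_norm_eventually_le hr2 ?_
  filter_upwards [h1.eventually_lt_const hr1] with n hn
  rw [norm_norm, norm_norm, hgSeries, coeff_mk, coeff_mk, hgCoeff, pow_succ]
  calc ‖(a + n) * (b + n) / ((n : ℝ) + 1) ^ 2 * hgCoeff a b n * (t ^ n * t)‖
      = (|(a + n) * (b + n) / ((n : ℝ) + 1) ^ 2| * |t|) * ‖hgCoeff a b n * t ^ n‖ := by
        simp only [norm_mul, Real.norm_eq_abs]; ring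
    _ ≤ _ := mul_le_mul_of_nonneg_right hn.le (norm_nonneg _)

theorem analyticAt_one_sub_rpow (x : ℝ) {u : ℝ} (hu : u < 1) :
    AnalyticAt ℝ (fun u : ℝ => (1 - u) ^ x) u := by
  have h1 : AnalyticAt ℝ (fun u : ℝ => 1 - u) u := analyticAt_const.sub analyticAt_id
  refine AnalyticAt.congr (f := fun u : ℝ => Real.exp (Real.log (1 - u) * x))
    (((h1.log (sub_pos.2 hu)).mul analyticAt_const).rexp) ?_
  filter_upwards [Iio_mem_nhds hu] with v hv
  rw [Real.rpow_def_of_pos (sub_pos.2 hv)]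

/-- Euler's transformation on `[0, 1)`. -/
theorem seriesSum_hgSeries_eq (x b : ℝ) {t : ℝ} (ht : t ∈ Set.Ico (0 : ℝ) 1) :
    seriesSum (hgSeries (1 - b - x) b) t =
      (1 - t) ^ x * seriesSum (hgSeries (x + b) (1 - b)) t := by
  have hsub : Set.Ico (0 : ℝ) 1 ⊆ Metric.eball 0 1 := fun u hu =>
    mem_eball_zero_one.2 (by rw [abs_of_nonneg hu.1]; exact hu.2)
  have hp : AnalyticOnNhd ℝ (fun u : ℝ => (1 - u) ^ x) (Set.Ico 0 1) := fun u hu =>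
    analyticAt_one_sub_rpow x hu.2
  have hY := (convergesOnUnitDisc_hgSeries (x + b) (1 - b)).analyticOnNhd.mono hsub
  have hF := (convergesOnUnitDisc_hgSeries (1 - b - x) b).analyticOnNhd.mono hsub
  have h0 : (0 : ℝ) ∈ Set.Ico (0 : ℝ) 1 := by simp
  refine eqOn_of_taylorSeries_eq hF (hp.mul hY) isPreconnected_Ico h0 ?_ ht
  have hmul := taylorSeries_mul (hp 0 h0) (hY 0 h0)
  rw [Pi.mul_def] at hmul
  rw [hmul, ConvergesOnUnitDisc.taylorSeries_seriesSum
    (convergesOnUnitDisc_hgSeries _ _), ConvergesOnUnitDisc.taylorSeries_seriesSum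
    (convergesOnUnitDisc_hgSeries _ _)]
  refine (euler_transformation x b (by simp [coeff_zero_taylorSeries]) ?_).symm
  have h1 : AnalyticAt ℝ (fun u : ℝ => 1 - u) 0 := analyticAt_const.sub analyticAt_id
  rw [← taylorSeries_deriv, ← taylorSeries_one_sub, ← taylorSeries_neg_const_mul,
    ← taylorSeries_mul h1 (hp 0 h0).deriv, Pi.mul_def]
  -- What remains is the equation (1 - u) p' = -x p for p(u) = (1 - u)^x near 0.
  refine taylorSeries_congr ?_
  filter_upwards [Iio_mem_nhds (zero_lt_one' ℝ)] with u hu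
  have hu' : 0 < 1 - u := sub_pos.2 hu
  have hd : HasDerivAt (fun u : ℝ => (1 - u) ^ x) (-1 * x * (1 - u) ^ (x - 1)) u :=
    ((hasDerivAt_id u).const_sub 1).rpow_const (Or.inl hu'.ne')
  rw [hd.deriv, Real.rpow_sub_one hu'.ne']
  field_simp

theorem hgCoeff_pos {a b : ℝ} (ha : 0 < a) (hb : 0 < b) (n : ℕ) : 0 < hgCoeff a b n := by
  induction n with
  | zero => simp [hgCoeff]
  | succ n ih => rw [hgCoeff]; positivity

/-- α may be negative, so the signs of the original coefficients do not help; after Euler's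
transformation both parameters x + b and 1 - b are positive. -/
theorem seriesSum_hgSeries_pos {x b : ℝ} (hx : 0 < x) (hb0 : 0 ≤ b) (hb1 : b < 1) {t : ℝ}
    (ht : t ∈ Set.Ico (0 : ℝ) 1) : 0 < seriesSum (hgSeries (1 - b - x) b) t := by
  rw [seriesSum_hgSeries_eq x b ht]
  refine mul_pos (Real.rpow_pos_of_pos (sub_pos.2 ht.2) _) ?_
  have hpos := hgCoeff_pos (a := x + b) (b := 1 - b) (by linarith) (by linarith)
  refine ((convergesOnUnitDisc_hgSeries _ _) t
    (by rw [abs_of_nonneg ht.1]; exact ht.2)).of_norm.tsum_pos (fun n => ?_) 0 ?_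
  · rw [hgSeries, coeff_mk]
    exact mul_nonneg (hpos n).le (pow_nonneg ht.1 n)
  · simp [hgSeries, hgCoeff]

/-- `log ₂F₁(α, b; 1; t)` has the Taylor coefficients `g_n`. -/
theorem hasFPowerSeriesAt_log_seriesSum (α b : ℝ) :
    HasFPowerSeriesAt (fun t => Real.log (seriesSum (hgSeries α b) t))
      (FormalMultilinearSeries.ofScalars ℝ (hyperLogCoeff α b)) 0 := by
  have hA := convergesOnUnitDisc_hgSeries α b
  have hF := hA.analyticOnNhd 0 (by simp)
  have hF0 : seriesSum (hgSeries α b) 0 = 1 := by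
    rw [seriesSum_zero]; simp [hgSeries, hgCoeff]
  have hG : AnalyticAt ℝ (fun t => Real.log (seriesSum (hgSeries α b) t)) 0 :=
    hF.log (by rw [hF0]; exact one_pos)
  refine hG.hasFPowerSeriesAt_of_taylorSeries_eq ?_
  have h1 : derivative ℝ (taylorSeries fun t => Real.log (seriesSum (hgSeries α b) t)) =
      PowerSeries.mk (fun n : ℕ => ((n : ℝ) + 1) * hyperLogCoeff α b (n + 1)) := by
    apply mul_right_cancel₀ (hgSeries_ne_zero α b)
    rw [mk_hyperLogCoeff_mul_hgSeries]
    have h2 := taylorSeries_mul hG.deriv hF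
    have h3 := taylorSeries_deriv (seriesSum (hgSeries α b))
    rw [hA.taylorSeries_seriesSum] at h2 h3
    rw [← taylorSeries_deriv, ← h2, ← h3]
    refine taylorSeries_congr ?_
    filter_upwards [hF.eventually_analyticAt,
      hF.continuousAt.eventually (lt_mem_nhds (by rw [hF0]; exact one_pos))] with t h2 h3
    rw [Pi.mul_apply, deriv.log h2.differentiableAt h3.ne']
    field_simp
  ext n
  rcases n with _ | n
  · rw [coeff_zero_taylorSeries, hF0]
    simp [hyperLogCoeff]
  · have h2 := congrArg (coeff n) h1
    rw [coeff_derivative, coeff_mk] at h2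
    rw [coeff_mk]
    exact mul_left_cancel₀ (by positivity : (n : ℝ) + 1 ≠ 0) (by linarith)

/-! ### Convergence at 1 and contiguous relations -/

/-- A form of Raabe's test. -/
theorem summable_and_tendsto_of_raabe {p : ℕ → ℝ} (hp : ∀ n, 0 ≤ p n) {c : ℝ} (hc : 0 < c)
    (h : ∀ᶠ n : ℕ in atTop, c * p n ≤ n * p n - ((n : ℝ) + 1) * p (n + 1)) :
    Summable p ∧ Tendsto (fun n : ℕ => (n : ℝ) * p n) atTop (𝓝 0) := by
  obtain ⟨m, hm⟩ := eventually_atTop.1 h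
  set v : ℕ → ℝ := fun n => ((n + m : ℕ) : ℝ) * p (n + m) with hv
  have hstep : ∀ n, c * p (n + m) ≤ v n - v (n + 1) := by
    intro n
    have := hm (n + m) (by omega)
    simp only [hv]
    rw [show n + 1 + m = n + m + 1 by omega]
    push_cast at this ⊢
    linarith
  have hv0 : ∀ n, 0 ≤ v n := fun n => mul_nonneg (Nat.cast_nonneg _) (hp _)
  have hanti : Antitone v := antitone_nat_of_succ_le fun n => by
    have := hstep n
    have := mul_nonneg hc.le (hp (n + m))
    linarith
  have hsum : Summable p := by
    rw [← summable_nat_add_iff m]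
    refine summable_of_sum_range_le (c := v 0 / c) (fun n => hp _) fun n => ?_
    rw [le_div_iff₀ hc, mul_comm, Finset.mul_sum]
    calc ∑ i ∈ Finset.range n, c * p (i + m) ≤ ∑ i ∈ Finset.range n, (v i - v (i + 1)) :=
          Finset.sum_le_sum fun i _ => hstep i
      _ = v 0 - v n := Finset.sum_range_sub' v n
      _ ≤ v 0 := by linarith [hv0 n]
  refine ⟨hsum, ?_⟩
  have hbdd : BddBelow (Set.range v) := ⟨0, by rintro _ ⟨n, rfl⟩; exact hv0 n⟩
  have hlim := tendsto_atTop_ciInf hanti hbdd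
  have hL0 : 0 ≤ ⨅ n, v n := le_ciInf hv0
  have hL : ⨅ n, v n = 0 := by
    -- A positive limit of n p_n would bound p_n below by a multiple of 1/n, against divergence of
    -- the harmonic series.
    by_contra hne
    have hpos : 0 < ⨅ n, v n := lt_of_le_of_ne hL0 (Ne.symm hne)
    apply Real.not_summable_one_div_natCast
    rw [← summable_nat_add_iff (m + 1)]
    refine Summable.of_nonneg_of_le (fun n => by positivity) (fun n => ?_)
      (((summable_nat_add_iff (m + 1)).2 hsum).div_const (⨅ n, v n))
    rw [div_le_div_iff₀ (by positivity) hpos, one_mul]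
    have := ciInf_le hbdd (n + 1)
    simp only [hv] at this ⊢
    rw [show n + (m + 1) = n + 1 + m by omega]
    linarith
  rw [hL] at hlim
  exact (tendsto_add_atTop_iff_nat m).1 hlim

/-- With p_n the absolute value of the coefficient, n p_n - (n + 1) p_{n+1} = ((1 - a - b) n - a b)
/ (n + 1) · p_n for large n. Half of the limiting constant 1 - a - b is used, leaving room for the
error. -/
theorem summable_hgCoeff_and_tendsto {a b : ℝ} (h : a + b < 1) :
    Summable (fun n => |hgCoeff a b n|) ∧
      Tendsto (fun n : ℕ => (n : ℝ) * |hgCoeff a b n|) atTop (𝓝 0) := by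
  refine summable_and_tendsto_of_raabe (fun n => abs_nonneg _) (c := (1 - a - b) / 2)
    (by linarith) ?_
  have h1 : ∀ᶠ n : ℕ in atTop, 0 ≤ a + n :=
    ((tendsto_natCast_atTop_atTop (R := ℝ)).eventually_ge_atTop (-a)).mono fun n hn => by linarith
  have h2 : ∀ᶠ n : ℕ in atTop, 0 ≤ b + n :=
    ((tendsto_natCast_atTop_atTop (R := ℝ)).eventually_ge_atTop (-b)).mono fun n hn => by linarith
  have h3 : ∀ᶠ n : ℕ in atTop, 1 + 2 * (a * b) / (1 - a - b) ≤ n :=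
    (tendsto_natCast_atTop_atTop (R := ℝ)).eventually_ge_atTop _
  filter_upwards [h1, h2, h3] with n h1 h2 h3
  have hx : 0 < 1 - a - b := by linarith
  have hn : (0 : ℝ) < n + 1 := by positivity
  have h4 := congrArg abs (hgCoeff_succ a b n)
  rw [abs_mul, abs_mul, abs_of_nonneg (mul_nonneg h1 h2), abs_of_pos (by positivity)] at h4
  have h5 : 2 * (a * b) ≤ (n - 1) * (1 - a - b) := by
    rw [← div_le_iff₀ hx]; linarith
  refine le_of_mul_le_mul_left ?_ hn
  have h6 : 0 ≤ |hgCoeff a b n| := abs_nonneg _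
  nlinarith [mul_nonneg h6 (sub_nonneg.2 h5)]

/-- The coefficients of `₂F₁(a, b; N + 1; t)`. -/
noncomputable def shiftedCoeff (a b : ℝ) (N n : ℕ) : ℝ := hgCoeff a b n / ((N + n).choose n : ℝ)

theorem abs_shiftedCoeff_le (a b : ℝ) (N n : ℕ) : |shiftedCoeff a b N n| ≤ |hgCoeff a b n| := by
  rw [shiftedCoeff, abs_div, Nat.abs_cast]
  refine div_le_self (abs_nonneg _) ?_
  exact_mod_cast Nat.choose_pos (Nat.le_add_left n N)

theorem choose_pos_cast (N n : ℕ) : (0 : ℝ) < ((N + n).choose n : ℝ) := by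
  exact_mod_cast Nat.choose_pos (Nat.le_add_left n N)

theorem shiftedCoeff_succ_left (a b : ℝ) (N n : ℕ) :
    ((N : ℝ) + 1 + n) * shiftedCoeff a b (N + 1) n = (N + 1) * shiftedCoeff a b N n := by
  have h : ((N : ℝ) + 1) * ((N + 1 + n).choose n : ℝ) = (N + 1 + n) * ((N + n).choose n : ℝ) := by
    have h1 := Nat.add_one_mul_choose_eq (N + n) N
    rw [Nat.choose_symm_add, show N + n + 1 = N + 1 + n by omega, Nat.choose_symm_add] at h1
    have h2 : ((N + 1 + n : ℕ) : ℝ) * ((N + n).choose n : ℝ) =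
      ((N + 1 + n).choose n : ℝ) * ((N + 1 : ℕ) : ℝ) := by exact_mod_cast h1
    push_cast at h2
    linarith
  have h1 := choose_pos_cast N n
  have h2 := choose_pos_cast (N + 1) n
  rw [shiftedCoeff, shiftedCoeff, mul_div_assoc', mul_div_assoc', div_eq_div_iff h2.ne' h1.ne']
  linear_combination (-hgCoeff a b n) * h

theorem shiftedCoeff_succ_right (a b : ℝ) (N n : ℕ) :
    ((N : ℝ) + 1 + n) * ((n + 1) * shiftedCoeff a b N (n + 1)) =
      (a + n) * (b + n) * shiftedCoeff a b N n := by
  have h : ((N : ℝ) + n + 1) * ((N + n).choose n : ℝ) =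
      ((N + (n + 1)).choose (n + 1) : ℝ) * (n + 1) := by
    exact_mod_cast Nat.add_one_mul_choose_eq (N + n) n
  have h1 := choose_pos_cast N n
  have h2 := choose_pos_cast N (n + 1)
  have h3 := hgCoeff_succ a b n
  have hn : (0 : ℝ) < n + 1 := by positivity
  rw [shiftedCoeff, shiftedCoeff, mul_div_assoc', mul_div_assoc', mul_div_assoc',
    div_eq_div_iff h2.ne' h1.ne']
  apply mul_right_cancel₀ hn.ne'
  linear_combination (n + 1) ^ 2 * hgCoeff a b (n + 1) * h +
    ((N + (n + 1)).choose (n + 1) : ℝ) * (n + 1) * h3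

/-- The contiguous relation between `₂F₁(a, b; c; 1)` and `₂F₁(a, b; c + 1; 1)`, `c = N + 1`. -/
theorem tsum_shiftedCoeff_succ {a b : ℝ} (h : a + b < 1) (N : ℕ) :
    ((N : ℝ) + 1) * (N + 1 - a - b) * ∑' n, shiftedCoeff a b N n =
      (N + 1 - a) * (N + 1 - b) * ∑' n, shiftedCoeff a b (N + 1) n := by
  obtain ⟨hs, ht⟩ := summable_hgCoeff_and_tendsto h
  have hsum : ∀ N, Summable (shiftedCoeff a b N) := fun N =>
    Summable.of_norm_bounded hs fun n => abs_shiftedCoeff_le a b N n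
  -- The termwise difference of the two sides telescopes through `v`, which vanishes at 0 and, by
  -- Raabe's test, at infinity.
  set v : ℕ → ℝ := fun n => (N + 1) * (n * shiftedCoeff a b N n) with hv
  have hstep : ∀ n, ((N : ℝ) + 1) * (N + 1 - a - b) * shiftedCoeff a b N n -
      (N + 1 - a) * (N + 1 - b) * shiftedCoeff a b (N + 1) n = v n - v (n + 1) := by
    intro n
    have h1 := shiftedCoeff_succ_left a b N n
    have h2 := shiftedCoeff_succ_right a b N n
    have hne : (N : ℝ) + 1 + n ≠ 0 := by positivity
    apply mul_left_cancel₀ hne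
    simp only [hv]
    push_cast
    linear_combination (-(N + 1 - a) * (N + 1 - b)) * h1 + (N + 1) * h2
  have hv0 : Tendsto v atTop (𝓝 0) := by
    have : Tendsto (fun n : ℕ => (n : ℝ) * shiftedCoeff a b N n) atTop (𝓝 0) := by
      refine squeeze_zero_norm (fun n => ?_) ht
      rw [norm_mul, Real.norm_natCast]
      exact mul_le_mul_of_nonneg_left (abs_shiftedCoeff_le a b N n) (Nat.cast_nonneg n)
    simpa using this.const_mul ((N : ℝ) + 1)
  have h1 := (((hsum N).hasSum.mul_left (((N : ℝ) + 1) * (N + 1 - a - b))).sub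
    ((hsum (N + 1)).hasSum.mul_left (((N : ℝ) + 1 - a) * (N + 1 - b)))).tendsto_sum_nat
  have h2 : Tendsto (fun n => v 0 - v n) atTop (𝓝 (v 0 - 0)) := hv0.const_sub _
  have h3 := tendsto_nhds_unique h1 (h2.congr fun n => by
    rw [← Finset.sum_range_sub']
    exact (Finset.sum_congr rfl fun i _ => hstep i).symm)
  have h4 : v 0 = 0 := by simp [hv]
  linarith

/-- Terms with n ≥ 1 vanish in the limit, since the binomial coefficient is at least N + 1; the
coefficients for N = 0 dominate uniformly in N. -/
theorem tendsto_tsum_shiftedCoeff {a b : ℝ} (h : a + b < 1) :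
    Tendsto (fun N => ∑' n, shiftedCoeff a b N n) atTop (𝓝 1) := by
  obtain ⟨hs, -⟩ := summable_hgCoeff_and_tendsto h
  have h1 : ∑' n : ℕ, (if n = 0 then (1 : ℝ) else 0) = 1 := by
    rw [tsum_eq_single 0 (by intro n hn; simp [hn])]; simp
  rw [← h1]
  refine tendsto_tsum_of_dominated_convergence hs (fun n => ?_)
    (Eventually.of_forall fun N n => abs_shiftedCoeff_le a b N n)
  rcases n with _ | n
  · simp [shiftedCoeff, hgCoeff]
  · rw [if_neg (Nat.succ_ne_zero n)]
    have h2 := (tendsto_one_div_add_atTop_nhds_zero_nat (𝕜 := ℝ)).const_mul |hgCoeff a b (n + 1)|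
    rw [mul_zero] at h2
    refine squeeze_zero_norm (fun N => ?_) h2
    have h3 : N + 1 ≤ (N + (n + 1)).choose (n + 1) := by
      rw [← Nat.choose_symm_add, ← Nat.choose_succ_self_right]
      exact Nat.choose_le_choose N (by omega)
    have h4 : (N : ℝ) + 1 ≤ ((N + (n + 1)).choose (n + 1) : ℝ) := by exact_mod_cast h3
    rw [shiftedCoeff, norm_div, Real.norm_natCast, Real.norm_eq_abs, mul_one_div]
    exact div_le_div_of_nonneg_left (abs_nonneg _) (by positivity) h4

/-! ### The infinite product and Gauss's summation -/

/-- The factors of the infinite product, indexed from `0`. -/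
noncomputable def jointFactorTerm (x b : ℝ) (k : ℕ) : ℝ :=
  ((k : ℝ) + 1) * (x + k) / (((k : ℝ) + 1 - b) * (x + k + b))

theorem prod_jointFactorTerm_mul {x b : ℝ} (hx : 0 < x) (hb0 : 0 ≤ b) (hb1 : b < 1) (N : ℕ) :
    (∏ k ∈ Finset.range N, jointFactorTerm x b k) * ∑' n, hgCoeff (1 - b - x) b n =
      ∑' n, shiftedCoeff (1 - b - x) b N n := by
  induction N with
  | zero => simp [shiftedCoeff]
  | succ N ih =>
    have h := tsum_shiftedCoeff_succ (a := 1 - b - x) (b := b) (by linarith) N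
    have h1 : (0 : ℝ) < N + 1 - b := by have := Nat.cast_nonneg (α := ℝ) N; linarith
    have h2 : (0 : ℝ) < x + N + b := by positivity
    rw [Finset.prod_range_succ, mul_right_comm, ih, jointFactorTerm, mul_div_assoc', div_eq_iff
      (mul_pos h1 h2).ne']
    linear_combination h

theorem tendsto_prod_jointFactorTerm {x b : ℝ} (hx : 0 < x) (hb0 : 0 ≤ b) (hb1 : b < 1) :
    Tendsto (fun N => ∏ k ∈ Finset.range N, jointFactorTerm x b k) atTop
      (𝓝 (Real.Gamma (x + b) * Real.Gamma (1 - b) / Real.Gamma x)) := by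
  rw [← tendsto_add_atTop_iff_nat 1]
  have h1 := ((Real.GammaSeq_tendsto_Gamma (x + b)).mul (Real.GammaSeq_tendsto_Gamma (1 - b))).div
    (Real.GammaSeq_tendsto_Gamma x) (Real.Gamma_pos_of_pos hx).ne'
  -- The quotient of Gamma sequences has n · n! where the product of n + 1 factors has (n + 1)!;
  -- this is the correction.
  have h2 : Tendsto (fun n : ℕ => 1 + 1 / (n : ℝ)) atTop (𝓝 1) := by
    simpa using (tendsto_one_div_atTop_nhds_zero_nat (𝕜 := ℝ)).const_add 1
  have h3 := h1.mul h2
  rw [mul_one] at h3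
  refine h3.congr' ?_
  filter_upwards [eventually_gt_atTop 0] with n hn
  have hn' : (0 : ℝ) < n := by exact_mod_cast hn
  have p1 : 0 < ∏ j ∈ Finset.range (n + 1), (x + b + (j : ℝ)) :=
    Finset.prod_pos fun j _ => by positivity
  have p2 : 0 < ∏ j ∈ Finset.range (n + 1), (1 - b + (j : ℝ)) :=
    Finset.prod_pos fun j _ => by have := Nat.cast_nonneg (α := ℝ) j; linarith
  have p3 : 0 < ∏ j ∈ Finset.range (n + 1), (x + (j : ℝ)) :=
    Finset.prod_pos fun j _ => by positivity
  have e1 : ∏ k ∈ Finset.range (n + 1), jointFactorTerm x b k =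
      ((n + 1).factorial : ℝ) * (∏ j ∈ Finset.range (n + 1), (x + (j : ℝ))) /
        ((∏ j ∈ Finset.range (n + 1), (1 - b + (j : ℝ))) *
          ∏ j ∈ Finset.range (n + 1), (x + b + (j : ℝ))) := by
    rw [← Finset.prod_range_add_one_eq_factorial]
    push_cast
    rw [← Finset.prod_mul_distrib, ← Finset.prod_mul_distrib, ← Finset.prod_div_distrib]
    refine Finset.prod_congr rfl fun k _ => ?_
    rw [jointFactorTerm]
    congr 1
    ring
  have e2 : (n : ℝ) ^ (x + b) * (n : ℝ) ^ (1 - b) = (n : ℝ) ^ x * n := by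
    rw [← Real.rpow_add hn', show x + b + (1 - b) = x + 1 by ring, Real.rpow_add hn',
      Real.rpow_one]
  rw [e1, Nat.factorial_succ]
  simp only [Pi.div_apply, Real.GammaSeq]
  have hx' : (0 : ℝ) < (n : ℝ) ^ x := Real.rpow_pos_of_pos hn' x
  have hf : (0 : ℝ) < (n.factorial : ℝ) := by exact_mod_cast n.factorial_pos
  push_cast
  generalize (∏ j ∈ Finset.range (n + 1), (x + b + (j : ℝ))) = q1 at *
  generalize (∏ j ∈ Finset.range (n + 1), (1 - b + (j : ℝ))) = q2 at *
  generalize (∏ j ∈ Finset.range (n + 1), (x + (j : ℝ))) = q3 at *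
  generalize (n : ℝ) ^ (x + b) = r1 at *
  generalize (n : ℝ) ^ (1 - b) = r2 at *
  generalize (n : ℝ) ^ x = r3 at *
  field_simp
  linear_combination e2

theorem multipliable_jointFactorTerm {x b : ℝ} (hx : 0 < x) (hb0 : 0 ≤ b) (hb1 : b < 1) :
    Multipliable (jointFactorTerm x b) := by
  -- Each factor minus 1 is exactly this term, which is O(1/k²).
  have h : Summable fun k : ℕ => b * (x + b - 1) / (((k : ℝ) + 1 - b) * (x + k + b)) := by
    rw [← summable_nat_add_iff 1]
    refine Summable.of_norm_bounded ((((summable_nat_add_iff 1).2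
      (Real.summable_one_div_nat_pow.2 one_lt_two)).mul_left |b * (x + b - 1)|)) fun k => ?_
    have hk := Nat.cast_nonneg (α := ℝ) k
    have h1 : (0 : ℝ) < k + 1 + 1 - b := by linarith
    have h2 : (0 : ℝ) < x + (k + 1) + b := by positivity
    push_cast
    rw [norm_div, Real.norm_eq_abs, Real.norm_eq_abs, abs_of_pos (mul_pos h1 h2), mul_one_div]
    refine div_le_div_of_nonneg_left (abs_nonneg _) (by positivity) ?_
    rw [sq]
    exact mul_le_mul (by linarith) (by linarith) (by positivity) h1.le
  refine (Real.multipliable_one_add_of_summable h).congr fun k => ?_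
  have hk := Nat.cast_nonneg (α := ℝ) k
  have h1 : (0 : ℝ) < k + 1 - b := by linarith
  have h2 : (0 : ℝ) < x + k + b := by positivity
  rw [jointFactorTerm]
  field_simp
  ring

theorem hasProd_jointFactorTerm {x b : ℝ} (hx : 0 < x) (hb0 : 0 ≤ b) (hb1 : b < 1) :
    HasProd (jointFactorTerm x b) (Real.Gamma (x + b) * Real.Gamma (1 - b) / Real.Gamma x) :=
  ((multipliable_jointFactorTerm hx hb0 hb1).hasProd_iff_tendsto_nat).2
    (tendsto_prod_jointFactorTerm hx hb0 hb1)

/-- Gauss's summation theorem. -/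
theorem gamma_mul_tsum_hgCoeff {x b : ℝ} (hx : 0 < x) (hb0 : 0 ≤ b) (hb1 : b < 1) :
    Real.Gamma (x + b) * Real.Gamma (1 - b) / Real.Gamma x * ∑' n, hgCoeff (1 - b - x) b n = 1 :=
  tendsto_nhds_unique ((tendsto_prod_jointFactorTerm hx hb0 hb1).mul_const _)
    ((tendsto_tsum_shiftedCoeff (by linarith)).congr fun N =>
      (prod_jointFactorTerm_mul hx hb0 hb1 N).symm)

/-! ### Absolute convergence for α between -1 and 1 -/

/-- The logarithmic derivative of the hypergeometric series. -/
noncomputable def logDerivCoeff (α b : ℝ) (n : ℕ) : ℝ := ((n : ℝ) + 1) * hyperLogCoeff α b (n + 1)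

theorem sum_logDerivCoeff_mul (α b : ℝ) (n : ℕ) :
    ∑ k ∈ Finset.range (n + 1), logDerivCoeff α b k * hgCoeff α b (n - k) =
      ((n : ℝ) + 1) * hgCoeff α b (n + 1) := by
  have h := congrArg (coeff n) (mk_hyperLogCoeff_mul_hgSeries α b)
  rw [coeff_mul, Finset.Nat.sum_antidiagonal_eq_sum_range_succ_mk, coeff_derivative] at h
  simp only [hgSeries, coeff_mk] at h
  rw [mul_comm ((n : ℝ) + 1)]
  exact h

/-- A truncation of the logarithmic derivative, up to the sign `σ`. -/
noncomputable def truncLogDeriv (σ α b : ℝ) (N : ℕ) : ℝ⟦X⟧ :=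
  PowerSeries.mk fun n => if n < N then σ * logDerivCoeff α b n else 0

theorem seriesSum_truncLogDeriv (σ α b : ℝ) (N : ℕ) (t : ℝ) :
    seriesSum (truncLogDeriv σ α b N) t =
      ∑ n ∈ Finset.range N, σ * logDerivCoeff α b n * t ^ n := by
  rw [seriesSum, tsum_eq_sum (s := Finset.range N)]
  · refine Finset.sum_congr rfl fun n hn => ?_
    rw [truncLogDeriv, coeff_mk, if_pos (Finset.mem_range.1 hn)]
  · intro n hn
    rw [truncLogDeriv, coeff_mk, if_neg (by simpa using hn), zero_mul]

theorem convergesOnUnitDisc_truncLogDeriv (σ α b : ℝ) (N : ℕ) :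
    ConvergesOnUnitDisc (truncLogDeriv σ α b N) := by
  intro t _
  refine summable_of_ne_finset_zero (s := Finset.range N) fun n hn => ?_
  rw [truncLogDeriv, coeff_mk, if_neg (by simpa using hn), zero_mul, norm_zero]

/-- If the logarithmic derivative has coefficients of one sign, and its truncations are dominated
accordingly, then the coefficients of the logarithm are summable. -/
theorem summable_hyperLogCoeff_of_sign {α b σ L : ℝ} (hσ : σ * σ = 1)
    (hpos : ∀ n, 0 ≤ σ * logDerivCoeff α b n)
    (hdom : ∀ N n, coeff n (truncLogDeriv σ α b N * hgSeries α b) ≤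
      σ * coeff n (derivative ℝ (hgSeries α b)))
    (hF : ∀ t ∈ Set.Ico (0 : ℝ) 1, 0 < seriesSum (hgSeries α b) t) (hL : 0 < L)
    (hlim : Tendsto (seriesSum (hgSeries α b)) (𝓝[<] 1) (𝓝 L)) :
    Summable (hyperLogCoeff α b) := by
  have hA := convergesOnUnitDisc_hgSeries α b
  have hF0 : seriesSum (hgSeries α b) 0 = 1 := by
    rw [seriesSum_zero]; simp [hgSeries, hgCoeff]
  have hbound : ∀ N, ∑ n ∈ Finset.range N, σ * hyperLogCoeff α b (n + 1) ≤ σ * Real.log L := by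
    intro N
    set S : ℝ → ℝ := fun t => ∑ n ∈ Finset.range N, σ * hyperLogCoeff α b (n + 1) * t ^ (n + 1)
      with hS
    have hSd : ∀ t, HasDerivAt S (seriesSum (truncLogDeriv σ α b N) t) t := by
      intro t
      rw [seriesSum_truncLogDeriv]
      refine HasDerivAt.fun_sum fun n _ => ?_
      refine ((hasDerivAt_pow (n + 1) t).const_mul (σ * hyperLogCoeff α b (n + 1))).congr_deriv ?_
      rw [logDerivCoeff, Nat.add_sub_cancel]
      push_cast
      ring
    -- φ starts at 0 and increases: after multiplication by F > 0, φ' ≥ 0 is the coefficientwise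
    -- bound `hdom`. Letting t → 1 gives the bound on the partial sum.
    set φ : ℝ → ℝ := fun t => σ * Real.log (seriesSum (hgSeries α b) t) - S t with hφ
    have hφd : ∀ t ∈ Set.Ico (0 : ℝ) 1, HasDerivAt φ
        (σ * (seriesSum (derivative ℝ (hgSeries α b)) t / seriesSum (hgSeries α b) t) -
          seriesSum (truncLogDeriv σ α b N) t) t := by
      intro t ht
      exact (((hA.hasDerivAt_seriesSum (by rw [abs_of_nonneg ht.1]; exact ht.2)).log
        (hF t ht).ne').const_mul σ).sub (hSd t)
    have hmono : MonotoneOn φ (Set.Ico 0 1) := by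
      refine monotoneOn_of_deriv_nonneg (convex_Ico 0 1)
        (fun t ht => (hφd t ht).continuousAt.continuousWithinAt) ?_ ?_
      · intro t ht
        rw [interior_Ico] at ht
        exact (hφd t ⟨ht.1.le, ht.2⟩).differentiableAt.differentiableWithinAt
      · intro t ht
        rw [interior_Ico] at ht
        have ht' : t ∈ Set.Ico (0 : ℝ) 1 := ⟨ht.1.le, ht.2⟩
        have hab : |t| < 1 := by rw [abs_of_pos ht.1]; exact ht.2
        have hW := convergesOnUnitDisc_truncLogDeriv σ α b N
        rw [(hφd t ht').deriv, sub_nonneg, mul_div_assoc', le_div_iff₀ (hF t ht'),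
          ← hW.seriesSum_mul hA hab, seriesSum, seriesSum, ← tsum_mul_left]
        refine ((hW.mul hA) t hab).of_norm.tsum_le_tsum (fun n => ?_)
          ((hA.derivative t hab).of_norm.mul_left σ)
        rw [← mul_assoc]
        exact mul_le_mul_of_nonneg_right (hdom N n) (pow_nonneg ht.1.le n)
    have hφ0 : φ 0 = 0 := by simp [hφ, hS, hF0]
    have hφlim : Tendsto φ (𝓝[<] 1) (𝓝 (σ * Real.log L - S 1)) :=
      ((hlim.log hL.ne').const_mul σ).sub
        ((hSd 1).continuousAt.tendsto.mono_left nhdsWithin_le_nhds)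
    have h0 : 0 ≤ σ * Real.log L - S 1 := by
      refine ge_of_tendsto hφlim ?_
      filter_upwards [Ioo_mem_nhdsLT (zero_lt_one' ℝ)] with t ht
      rw [← hφ0]
      exact hmono (by simp) ⟨ht.1.le, ht.2⟩ ht.1.le
    have hS1 : S 1 = ∑ n ∈ Finset.range N, σ * hyperLogCoeff α b (n + 1) := by simp [hS]
    linarith
  have hnn : ∀ n, 0 ≤ σ * hyperLogCoeff α b (n + 1) := by
    intro n
    have h := hpos n
    rw [logDerivCoeff, mul_left_comm] at h
    exact nonneg_of_mul_nonneg_right h (by positivity)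
  rw [← summable_nat_add_iff 1]
  refine ((summable_of_sum_range_le hnn hbound).mul_left σ).congr fun n => ?_
  rw [← mul_assoc, hσ, one_mul]

theorem coeff_truncLogDeriv_mul (σ α b : ℝ) (N n : ℕ) :
    coeff n (truncLogDeriv σ α b N * hgSeries α b) =
      ∑ k ∈ Finset.range (n + 1),
        (if k < N then σ * logDerivCoeff α b k else 0) * hgCoeff α b (n - k) := by
  rw [coeff_mul, Finset.Nat.sum_antidiagonal_eq_sum_range_succ_mk]
  simp [truncLogDeriv, hgSeries]

theorem mul_coeff_derivative_hgSeries (σ α b : ℝ) (n : ℕ) :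
    σ * coeff n (derivative ℝ (hgSeries α b)) =
      ∑ k ∈ Finset.range (n + 1), σ * logDerivCoeff α b k * hgCoeff α b (n - k) := by
  simp_rw [mul_assoc]
  rw [← Finset.mul_sum, sum_logDerivCoeff_mul, coeff_derivative, hgSeries, coeff_mk, mul_comm (hgCoeff α b (n + 1))]

theorem hgCoeff_nonneg {a b : ℝ} (ha : 0 ≤ a) (hb : 0 ≤ b) (n : ℕ) : 0 ≤ hgCoeff a b n := by
  induction n with
  | zero => simp [hgCoeff]
  | succ n ih => rw [hgCoeff]; positivity

/-- Only the first factor a of the rising factorial can be negative, as a + n ≥ 0 for n ≥ 1. -/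
theorem hgCoeff_succ_nonpos {a b : ℝ} (ha0 : -1 ≤ a) (ha1 : a ≤ 0) (hb : 0 ≤ b) (n : ℕ) :
    hgCoeff a b (n + 1) ≤ 0 := by
  induction n with
  | zero => simpa [hgCoeff] using mul_nonpos_of_nonpos_of_nonneg ha1 hb
  | succ n ih =>
    rw [hgCoeff]
    refine mul_nonpos_of_nonneg_of_nonpos ?_ ih
    have : (0 : ℝ) ≤ a + ((n + 1 : ℕ) : ℝ) := by
      push_cast
      linarith [Nat.cast_nonneg (α := ℝ) n]
    positivity

/-- The ratios of consecutive coefficients increase. -/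
theorem monotone_hgCoeff_ratio {a b : ℝ} (ha0 : 0 ≤ a) (ha1 : a ≤ 1) (hb0 : 0 ≤ b) (hb1 : b ≤ 1) :
    Monotone fun n : ℕ => (a + n) * (b + n) / ((n : ℝ) + 1) ^ 2 := by
  have h : ∀ a : ℝ, a ≤ 1 → Monotone fun n : ℕ => (a + n) / ((n : ℝ) + 1) := by
    intro a ha m n hmn
    have hmn' : (m : ℝ) ≤ n := by exact_mod_cast hmn
    rw [div_le_div_iff₀ (by positivity) (by positivity)]
    nlinarith [mul_nonneg (sub_nonneg.2 ha) (sub_nonneg.2 hmn')]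
  intro m n hmn
  have := mul_le_mul (h a ha1 hmn) (h b hb1 hmn) (by positivity) (by positivity)
  simpa only [div_mul_div_comm, ← sq] using this

/-- Kaluza's argument: the logarithm of a series with log-convex coefficients has nonnegative
coefficients. -/
theorem logDerivCoeff_nonneg {α b : ℝ} (hα0 : 0 ≤ α) (hα1 : α ≤ 1) (hb0 : 0 ≤ b) (hb1 : b ≤ 1)
    (n : ℕ) : 0 ≤ logDerivCoeff α b n := by
  induction n using Nat.strong_induction_on with
  | _ n ih =>
    rcases n with _ | m
    · simpa [logDerivCoeff, hyperLogCoeff] using mul_nonneg hα0 hb0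
    have h1 := sum_logDerivCoeff_mul α b m
    have h2 := sum_logDerivCoeff_mul α b (m + 1)
    rw [Finset.sum_range_succ, Nat.sub_self] at h2
    have hr := monotone_hgCoeff_ratio hα0 hα1 hb0 hb1
    set r : ℕ → ℝ := fun n : ℕ => (α + n) * (b + n) / ((n : ℝ) + 1) ^ 2
    have hsucc : ∀ n, hgCoeff α b (n + 1) = r n * hgCoeff α b n := fun n => rfl
    -- Writing c for the coefficients, each ratio c_{m+1-k} / c_{m-k} is at most r_{m+1}. So the sum
    -- is at most (m + 1) c_{m+2}, short of the required total (m + 2) c_{m+2}; the new coefficient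
    -- makes up the nonnegative rest.
    have h3 : ∑ k ∈ Finset.range (m + 1), logDerivCoeff α b k * hgCoeff α b (m + 1 - k) ≤
        r (m + 1) * ∑ k ∈ Finset.range (m + 1), logDerivCoeff α b k * hgCoeff α b (m - k) := by
      rw [Finset.mul_sum]
      refine Finset.sum_le_sum fun k hk => ?_
      have hk' := Finset.mem_range.1 hk
      rw [show m + 1 - k = m - k + 1 by omega, hsucc, mul_left_comm]
      exact mul_le_mul_of_nonneg_right (hr (by omega))
        (mul_nonneg (ih k hk') (hgCoeff_nonneg hα0 hb0 _))
    rw [h1, mul_left_comm, ← hsucc] at h3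
    have h4 := hgCoeff_nonneg hα0 hb0 (m + 1 + 1)
    have h5 : hgCoeff α b 0 = 1 := by rw [hgCoeff]
    rw [h5] at h2
    push_cast at h2
    linarith

theorem logDerivCoeff_nonpos {α b : ℝ} (hα0 : -1 ≤ α) (hα1 : α ≤ 0) (hb : 0 ≤ b) (n : ℕ) :
    logDerivCoeff α b n ≤ 0 := by
  induction n using Nat.strong_induction_on with
  | _ n ih =>
    have h1 := sum_logDerivCoeff_mul α b n
    rw [Finset.sum_range_succ, Nat.sub_self] at h1
    have h2 : 0 ≤ ∑ k ∈ Finset.range n, logDerivCoeff α b k * hgCoeff α b (n - k) := by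
      refine Finset.sum_nonneg fun k hk => ?_
      have hk' := Finset.mem_range.1 hk
      obtain ⟨j, hj⟩ : ∃ j, n - k = j + 1 := ⟨n - k - 1, by omega⟩
      rw [hj]
      exact mul_nonneg_of_nonpos_of_nonpos (ih k hk') (hgCoeff_succ_nonpos hα0 hα1 hb j)
    have h3 : ((n : ℝ) + 1) * hgCoeff α b (n + 1) ≤ 0 :=
      mul_nonpos_of_nonneg_of_nonpos (by positivity) (hgCoeff_succ_nonpos hα0 hα1 hb n)
    have h5 : hgCoeff α b 0 = 1 := by rw [hgCoeff]
    rw [h5] at h1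
    linarith

theorem summable_hyperLogCoeff {α b L : ℝ} (hα0 : -1 ≤ α) (hα1 : α ≤ 1) (hb0 : 0 ≤ b) (hb1 : b ≤ 1)
    (hF : ∀ t ∈ Set.Ico (0 : ℝ) 1, 0 < seriesSum (hgSeries α b) t) (hL : 0 < L)
    (hlim : Tendsto (seriesSum (hgSeries α b)) (𝓝[<] 1) (𝓝 L)) :
    Summable (hyperLogCoeff α b) := by
  rcases le_total 0 α with hα | hα
  · have hu := logDerivCoeff_nonneg hα hα1 hb0 hb1
    refine summable_hyperLogCoeff_of_sign (σ := 1) (by norm_num) (fun n => by simpa using hu n)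
      (fun N n => ?_) hF hL hlim
    rw [coeff_truncLogDeriv_mul, mul_coeff_derivative_hgSeries]
    refine Finset.sum_le_sum fun k _ => mul_le_mul_of_nonneg_right ?_ (hgCoeff_nonneg hα hb0 _)
    split_ifs
    · exact le_rfl
    · simpa using hu k
  · have hu := logDerivCoeff_nonpos hα0 hα hb0
    refine summable_hyperLogCoeff_of_sign (σ := -1) (by norm_num) (fun n => by simpa using hu n)
      (fun N n => ?_) hF hL hlim
    rw [coeff_truncLogDeriv_mul]
    rcases lt_or_ge n N with hn | hn
    · rw [mul_coeff_derivative_hgSeries]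
      refine (Finset.sum_congr rfl fun k hk => ?_).le
      rw [if_pos (by have := Finset.mem_range.1 hk; omega)]
    -- Here k < N ≤ n forces n - k ≥ 1, so every factor `hgCoeff α b (n - k)` that survives
    -- truncation is nonpositive.
    · calc _ ≤ (0 : ℝ) := Finset.sum_nonpos fun k _ => ?_
        _ ≤ _ := ?_
      · split_ifs with hk
        · obtain ⟨j, hj⟩ : ∃ j, n - k = j + 1 := ⟨n - k - 1, by omega⟩
          rw [hj]
          exact mul_nonpos_of_nonneg_of_nonpos (by simpa using hu k)
            (hgCoeff_succ_nonpos hα0 hα hb0 j)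
        · rw [zero_mul]
      · rw [coeff_derivative, hgSeries, coeff_mk]
        have h3 : hgCoeff α b (n + 1) * ((n : ℝ) + 1) ≤ 0 :=
          mul_nonpos_of_nonpos_of_nonneg (hgCoeff_succ_nonpos hα0 hα hb0 n) (by positivity)
        linarith

/-! ### Uniqueness of the joint factor, Abel's theorem and conclusion -/

theorem Ico_subset_eball : Set.Ico (0 : ℝ) 1 ⊆ Metric.eball 0 1 := fun u hu =>
  mem_eball_zero_one.2 (by rw [abs_of_nonneg hu.1]; exact hu.2)

theorem tendsto_seriesSum_nhdsLT {Z : ℝ⟦X⟧} {s : ℝ}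
    (h : Tendsto (fun n => ∑ i ∈ Finset.range n, coeff i Z) atTop (𝓝 s)) :
    Tendsto (seriesSum Z) (𝓝[<] 1) (𝓝 s) :=
  Real.tendsto_tsum_powerSeries_nhdsWithin_lt h

theorem IsJointFactor.unique {x b f f' : ℝ} (h : IsJointFactor x b f) (h' : IsJointFactor x b f') :
    f = f' := by
  obtain ⟨G, s, hG, hGa, hGs, rfl⟩ := h
  obtain ⟨G', s', hG', hGa', hGs', rfl⟩ := h'
  have heq := eqOn_of_taylorSeries_eq hGa hGa' isPreconnected_Ico (by simp)
    (by rw [taylorSeries_eq_mk hG, taylorSeries_eq_mk hG'])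
  have hev : G =ᶠ[𝓝[<] 1] G' := by
    filter_upwards [Ioo_mem_nhdsLT (zero_lt_one' ℝ)] with t ht using heq ⟨ht.1.le, ht.2⟩
  rw [tendsto_nhds_unique hGs (hGs'.congr' hev.symm)]

/-- By Abel's theorem, the ordinary sum gives the joint factor where the series converges. -/
theorem isJointFactor_of_tendsto {x b s : ℝ}
    (h : Tendsto (fun N : ℕ => ∑ n ∈ Finset.Icc 1 N, jointCoeff x b n) atTop (𝓝 s)) :
    IsJointFactor x b (Real.exp (-s)) := by
  set Z : ℝ⟦X⟧ := PowerSeries.mk (jointCoeff x b) with hZ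
  have hc : ∀ n, coeff n Z = jointCoeff x b n := fun n => coeff_mk n _
  have h1 : Tendsto (fun n => ∑ i ∈ Finset.range n, coeff i Z) atTop (𝓝 s) := by
    rw [← tendsto_add_atTop_iff_nat 1]
    refine h.congr fun N => ?_
    rw [Finset.sum_range_succ', hc, show jointCoeff x b 0 = 0 by simp [jointCoeff, hyperLogCoeff],
      add_zero, Finset.range_eq_Ico, Finset.sum_Ico_add' (fun i => coeff i Z), zero_add]
    exact Finset.sum_congr rfl fun n _ => (hc n).symm
  -- Convergence at 1 makes the coefficients bounded, so the series itself converges on the whole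
  -- disc and serves as G.
  have h2 : Tendsto (fun n => coeff n Z) atTop (𝓝 0) := by
    have := (h1.comp (tendsto_add_atTop_nat 1)).sub h1
    rw [sub_self] at this
    refine this.congr fun n => ?_
    simp [Finset.sum_range_succ]
  obtain ⟨K, hK⟩ := h2.abs.bddAbove_range
  have hZc : ConvergesOnUnitDisc Z :=
    ConvergesOnUnitDisc.of_bounded (K := K) fun n => hK ⟨n, rfl⟩
  refine ⟨seriesSum Z, s, ?_, hZc.analyticOnNhd.mono Ico_subset_eball,
    tendsto_seriesSum_nhdsLT h1, rfl⟩
  have := hZc.hasFPowerSeriesOnBall.hasFPowerSeriesAt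
  simpa only [hc] using this

theorem theorem2p1 (x b : ℝ) (hx : 0 < x) (hb0 : 0 ≤ b) (hb1 : b < 1) :
    ∃ f : ℝ,
      -- `f` is the joint factor: it exists and is unique
      (∀ f' : ℝ, IsJointFactor x b f' ↔ f' = f) ∧
      -- it is `exp (-∑ g_n)` in the literal sense wherever the series converges
      (∀ s : ℝ,
        Filter.Tendsto (fun N : ℕ => ∑ n ∈ Finset.Icc 1 N, jointCoeff x b n)
          Filter.atTop (nhds s) → f = Real.exp (-s)) ∧
      -- and the series converges (absolutely) at least for `x + b ≤ 2`
      (x + b ≤ 2 → Summable (jointCoeff x b)) ∧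
      -- the infinite product
      HasProd (fun k : ℕ+ =>
        ((k : ℕ) : ℝ) * (x + ((k : ℕ) : ℝ) - 1) /
          ((((k : ℕ) : ℝ) - b) * (x + ((k : ℕ) : ℝ) + b - 1))) f ∧
      -- the form with Gamma functions
      f = Real.Gamma (x + b) * Real.Gamma (1 - b) / Real.Gamma x := by
  set f := Real.Gamma (x + b) * Real.Gamma (1 - b) / Real.Gamma x with hf
  have hfpos : 0 < f := div_pos (mul_pos (Real.Gamma_pos_of_pos (by linarith))
    (Real.Gamma_pos_of_pos (by linarith))) (Real.Gamma_pos_of_pos hx)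
  have hgauss := gamma_mul_tsum_hgCoeff hx hb0 hb1
  rw [← hf] at hgauss
  set L := ∑' n, hgCoeff (1 - b - x) b n with hLdef
  -- Gauss's theorem reads f L = 1, which gives both L > 0 and f = exp (-log L).
  have hL : 0 < L := pos_of_mul_pos_right (by rw [hgauss]; exact one_pos) hfpos.le
  have hlim : Tendsto (seriesSum (hgSeries (1 - b - x) b)) (𝓝[<] 1) (𝓝 L) := by
    apply tendsto_seriesSum_nhdsLT
    have hs := (summable_hgCoeff_and_tendsto (a := 1 - b - x) (b := b) (by linarith)).1.of_abs
    simpa [hgSeries] using hs.hasSum.tendsto_sum_nat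
  have hF := fun t (ht : t ∈ Set.Ico (0 : ℝ) 1) => seriesSum_hgSeries_pos hx hb0 hb1 ht
  have hJ : IsJointFactor x b f := by
    refine ⟨fun t => Real.log (seriesSum (hgSeries (1 - b - x) b) t), Real.log L,
      hasFPowerSeriesAt_log_seriesSum _ _, fun t ht => ?_, hlim.log hL.ne', ?_⟩
    · exact ((convergesOnUnitDisc_hgSeries _ _).analyticOnNhd t (Ico_subset_eball ht)).log (hF t ht)
    · rw [Real.exp_neg, Real.exp_log hL]
      exact eq_inv_of_mul_eq_one_left hgauss
  refine ⟨f, fun f' => ⟨fun h => h.unique hJ, fun h => h ▸ hJ⟩,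
    fun s hs => hJ.unique (isJointFactor_of_tendsto hs), fun hxb => ?_, ?_, rfl⟩
  · exact summable_hyperLogCoeff (by linarith) (by linarith) hb0 hb1.le hF hL hlim
  · have h := hasProd_jointFactorTerm hx hb0 hb1
    rw [← hf] at h
    refine (hasProd_pnat_iff_hasProd_succ (f := fun k : ℕ => (k : ℝ) * (x + (k : ℝ) - 1) /
      (((k : ℝ) - b) * (x + (k : ℝ) + b - 1)))).2 (h.congr_fun fun k => ?_)
    rw [jointFactorTerm]
    push_cast
    congr 1 <;> ring
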